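/- **Theorem (omitting types).** Let $\mathcal L$ be a countable first-order language (with function and relation symbols of arbitrary finite arities, including $0$). Consider formulas of $\mathcal L_{\omega_1\omega}$, i.e., first-order formulas with countable conjunctions and disjunctions allowed, each with finitely many free variables; structures are allowed to be empty. A $\Sigma_1$ formula is one built from atomic formulas (including equations, but no negated atomic formulas) using finite conjunctions (including $\top$), countable disjunctions $\bigvee$ and $\exists$. A $\Sigma_2$ formula is one built from $\Sigma_1$ formulas and their negations using finite conjunctions, countable disjunctions and $\exists$. A $\Pi_2$ formula is the dual of a $\Sigma_2$ formula; up to logical equivalence, it is one of the form $\bigwedge_k \forall \vec y_k\,(\alpha_k(\vec x,\vec y_k)\to\beta_k(\vec x,\vec y_k))$, where the conjunction is countable and all $\alpha_k,\beta_k$ are $\Sigma_1$. Let $\mathcal T$ be a countable set of $\Pi_2$ sentences which is satisfiable, i.e., has a model. (a) Let $\phi_i(\vec x_i)$ be countably many $\Pi_2$ formulas, of various arities $n_i\in\mathbb N$, such that for each $i$ and each $\Sigma_1$ formula $\theta(\vec x_i)$ which is satisfiable in some model of $\mathcal T$, the formula $\phi_i\wedge\theta$ is also satisfiable in some model of $\mathcal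 T$. Then $\mathcal T\cup\{\forall\vec x_i\,\phi_i(\vec x_i)\}_i$ is satisfiable. (b) Let $\psi_i(\vec x_i)$ be countably many $\Sigma_2$ formulas, of various arities $n_i\in\mathbb N$, such that for each $i$ and each $\Sigma_1$ formula $\theta(\vec x_i)$, if $\mathcal T\models\forall\vec x_i\,(\theta(\vec x_i)\to\psi_i(\vec x_i))$, then $\mathcal T\models\forall\vec x_i\,\neg\theta(\vec x_i)$. Then $\mathcal T\cup\{\forall\vec x_i\,\neg\psi_i(\vec x_i)\}_i$ is satisfiable. -/

import Mathlib

universe u v w x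

namespace InfinitaryLogic

/-- Formulas of the countably infinitary logic over the first-order language `L` whose free
variables are among `x_0, …, x_{n-1}`. Conjunctions and disjunctions are over arbitrary countable
index sets, represented as subsets of `ℕ`; a quantifier binds the last variable. -/
inductive Formula (L : FirstOrder.Language.{u, v}) : ℕ → Type (max u v)
  | equal {n : ℕ} (s t : L.Term (Fin n)) : Formula L n
  | rel {n l : ℕ} (R : L.Relations l) (ts : Fin l → L.Term (Fin n)) : Formula L n
  | neg {n : ℕ} (φ : Formula L n) : Formula L n
  | conj {n : ℕ} (I : Set ℕ) (φ : I → Formula L n) : Formula L n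
  | disj {n : ℕ} (I : Set ℕ) (φ : I → Formula L n) : Formula L n
  | all {n : ℕ} (φ : Formula L (n + 1)) : Formula L n
  | ex {n : ℕ} (φ : Formula L (n + 1)) : Formula L n

namespace Formula

variable {L : FirstOrder.Language.{u, v}}

/-- Tarskian satisfaction; the structure `M` may be empty. -/
def Realize {M : Type w} [L.Structure M] :
    {n : ℕ} → Formula L n → (Fin n → M) → Prop
  | _, equal s t, a => s.realize a = t.realize a
  | _, rel R ts, a => FirstOrder.Language.Structure.RelMap R (fun i => (ts i).realize a)
  | _, neg φ, a => ¬ φ.Realize a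
  | _, conj _ φ, a => ∀ i, (φ i).Realize a
  | _, disj _ φ, a => ∃ i, (φ i).Realize a
  | _, all φ, a => ∀ b : M, φ.Realize (Fin.snoc (α := fun _ => M) a b)
  | _, ex φ, a => ∃ b : M, φ.Realize (Fin.snoc (α := fun _ => M) a b)

/-- Binary conjunction. -/
def and {n : ℕ} (φ ψ : Formula L n) : Formula L n :=
  conj {0, 1} (fun i => if (i : ℕ) = 0 then φ else ψ)

/-- Binary disjunction. -/
def or {n : ℕ} (φ ψ : Formula L n) : Formula L n :=
  disj {0, 1} (fun i => if (i : ℕ) = 0 then φ else ψ)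

/-- Implication, as an abbreviation. -/
def imp {n : ℕ} (φ ψ : Formula L n) : Formula L n := or (neg φ) ψ

/-- The universal closure of a formula. -/
def alls : {n : ℕ} → Formula L n → Formula L 0
  | 0, φ => φ
  | _ + 1, φ => alls (all φ)

/-- `Σ₁` formulas: built from atomic formulas (equations included, negations excluded) using finite
conjunctions, the empty one being `⊤`, countable disjunctions and `∃`. -/
inductive IsSigmaOne : {n : ℕ} → Formula L n → Prop
  | equal {n : ℕ} (s t : L.Term (Fin n)) : IsSigmaOne (equal s t)
  | rel {n l : ℕ} (R : L.Relations l) (ts : Fin l → L.Term (Fin n)) : IsSigmaOne (rel R ts)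
  | conj {n : ℕ} (I : Set ℕ) (φ : I → Formula L n) (hI : I.Finite)
      (h : ∀ i, IsSigmaOne (φ i)) : IsSigmaOne (conj I φ)
  | disj {n : ℕ} (I : Set ℕ) (φ : I → Formula L n)
      (h : ∀ i, IsSigmaOne (φ i)) : IsSigmaOne (disj I φ)
  | ex {n : ℕ} (φ : Formula L (n + 1)) (h : IsSigmaOne φ) : IsSigmaOne (ex φ)

/-- `Σ₂` formulas: built from `Σ₁` formulas and their negations using finite conjunctions,
countable disjunctions and `∃`. -/
inductive IsSigmaTwo : {n : ℕ} → Formula L n → Prop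
  | sigmaOne {n : ℕ} (φ : Formula L n) (h : IsSigmaOne φ) : IsSigmaTwo φ
  | neg_sigmaOne {n : ℕ} (φ : Formula L n) (h : IsSigmaOne φ) : IsSigmaTwo (neg φ)
  | conj {n : ℕ} (I : Set ℕ) (φ : I → Formula L n) (hI : I.Finite)
      (h : ∀ i, IsSigmaTwo (φ i)) : IsSigmaTwo (conj I φ)
  | disj {n : ℕ} (I : Set ℕ) (φ : I → Formula L n)
      (h : ∀ i, IsSigmaTwo (φ i)) : IsSigmaTwo (disj I φ)
  | ex {n : ℕ} (φ : Formula L (n + 1)) (h : IsSigmaTwo φ) : IsSigmaTwo (ex φ)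

/-- `Π₂` formulas, the duals of `Σ₂` formulas: built from `Σ₁` formulas and their negations using
finite disjunctions, countable conjunctions and `∀`. Since `⋀` and `∀` may also be read as
abbreviations for `¬⋁¬` and `¬∃¬`, negations of `Σ₂` formulas are admitted as well. -/
inductive IsPiTwo : {n : ℕ} → Formula L n → Prop
  | sigmaOne {n : ℕ} (φ : Formula L n) (h : IsSigmaOne φ) : IsPiTwo φ
  | neg_sigmaTwo {n : ℕ} (φ : Formula L n) (h : IsSigmaTwo φ) : IsPiTwo (neg φ)
  | disj {n : ℕ} (I : Set ℕ) (φ : I → Formula L n) (hI : I.Finite)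
      (h : ∀ i, IsPiTwo (φ i)) : IsPiTwo (disj I φ)
  | conj {n : ℕ} (I : Set ℕ) (φ : I → Formula L n)
      (h : ∀ i, IsPiTwo (φ i)) : IsPiTwo (conj I φ)
  | all {n : ℕ} (φ : Formula L (n + 1)) (h : IsPiTwo φ) : IsPiTwo (all φ)

end Formula

/-- A sentence is a formula without free variables. -/
abbrev Sentence (L : FirstOrder.Language.{u, v}) : Type (max u v) := Formula L 0

/-- A theory is a set of sentences. -/
abbrev Theory (L : FirstOrder.Language.{u, v}) : Type (max u v) := Set (Sentence L)

/-- The structure `M` is a model of the theory `T`. -/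
def IsModel {L : FirstOrder.Language.{u, v}} (M : Type w) [L.Structure M] (T : Theory L) : Prop :=
  ∀ σ ∈ T, σ.Realize (Fin.elim0 : Fin 0 → M)

/-- `T` has a model, possibly empty. -/
def Satisfiable {L : FirstOrder.Language.{u, v}} (T : Theory L) : Prop :=
  ∃ (M : Type w) (_ : L.Structure M), IsModel M T

/-- The formula `φ` is satisfied by some tuple in some model of `T`. -/
def SatisfiableOver {L : FirstOrder.Language.{u, v}} (T : Theory L) {n : ℕ} (φ : Formula L n) : Prop :=
  ∃ (M : Type w) (_ : L.Structure M), IsModel M T ∧ ∃ a : Fin n → M, φ.Realize a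

/-- `T ⊨ σ`: the sentence `σ` holds in every model of `T`. -/
def Entails {L : FirstOrder.Language.{u, v}} (T : Theory L) (σ : Sentence L) : Prop :=
  ∀ (M : Type w) [L.Structure M], IsModel M T → σ.Realize (Fin.elim0 : Fin 0 → M)

end InfinitaryLogic

/-! This is a Henkin construction by forcing with `Σ₁` formulas. A `Point` is a model of `T` with
values for a countable set `V` of variables, and the conditions are the nonempty sets of points cut
out by a `Σ₁` formula. A sufficiently generic filter `F` of conditions (`exists_generic_filter`)
turns `V`, modulo eventual equality, into a structure in which an atomic formula holds when it holds
eventually along `F`.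

Genericity names witnesses for `∃` and selects disjuncts of `⋁`, so a `Σ₁` formula true frequently
along `F` is true in this structure, and conversely its truth there forces it eventually. Hence a
`Π₂` formula true frequently along `F` is true in the structure (`IsGeneric.realize_of_isPiTwo`).
The hypothesis of (a) says exactly that no condition excludes `φ i` at any variables
(`inter_sat_nonempty`), so `φ i` is frequently true at every tuple, while sentences of `T` hold at
all points. Part (b) is (a) for the negations. -/

open Filter Set

namespace InfinitaryLogic

/-! ### Generic filters -/

/-- A form of the Rasiowa–Sikorski lemma: given a family `B` of sets closed under intersections and
countably many families `C ⊆ B`, there is a filter based on `B` containing a member of each family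
`C` whose union it does not exclude. -/
theorem exists_generic_filter {X : Type*} [Nonempty X] (B : Set (Set X)) (huniv : univ ∈ B)
    (hinter : ∀ s ∈ B, ∀ t ∈ B, s ∩ t ∈ B) (𝓒 : Set (Set (Set X))) (h𝓒 : 𝓒.Countable) :
    ∃ F : Filter X, F.NeBot ∧ (∀ s ∈ F, ∃ t ∈ F, t ∈ B ∧ t ⊆ s) ∧
      ∀ C ∈ 𝓒, C ⊆ B → (∃ᶠ x in F, x ∈ ⋃₀ C) → ∃ A ∈ C, A ∈ F := by
  let P := {s : Set X // s ∈ B ∧ s.Nonempty}ᵒᵈ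
  let D (C : Set (Set X)) : Set P := {q | ∃ A ∈ C, (OrderDual.ofDual q).1 ⊆ A}
  -- Density of `D C` is not assumed: a condition either extends into `D C` or already rules out all
  -- such extensions.
  have hD (C : Set (Set X)) : IsCofinal {q : P | q ∈ D C ∨ ∀ r, q ≤ r → r ∉ D C} := by
    intro q
    by_cases h : ∃ r, q ≤ r ∧ r ∈ D C
    · obtain ⟨r, hqr, hr⟩ := h
      exact ⟨r, Or.inl hr, hqr⟩
    · exact ⟨q, Or.inr fun r hqr hr => h ⟨r, hqr, hr⟩, le_rfl⟩
  have : Countable 𝓒 := h𝓒.to_subtype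
  have : Encodable 𝓒 := Encodable.ofCountable 𝓒
  let p : P := OrderDual.toDual ⟨univ, huniv, univ_nonempty⟩
  let 𝒟 (C : 𝓒) : Order.Cofinal P := ⟨_, hD C⟩
  let I := Order.idealOfCofinals p 𝒟
  let F : Filter X :=
    { sets := {s | ∃ q ∈ I, (OrderDual.ofDual q).1 ⊆ s}
      univ_sets := ⟨p, Order.mem_idealOfCofinals p 𝒟, subset_univ _⟩
      sets_of_superset := fun ⟨q, hq, hs⟩ hst => ⟨q, hq, hs.trans hst⟩
      inter_sets := fun ⟨q, hq, hs⟩ ⟨r, hr, ht⟩ => by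
        obtain ⟨t, htI, hqt, hrt⟩ := I.directed q hq r hr
        exact ⟨t, htI, subset_inter (Subset.trans hqt hs) (Subset.trans hrt ht)⟩ }
  have hF {s : Set X} : s ∈ F ↔ ∃ q ∈ I, (OrderDual.ofDual q).1 ⊆ s := Iff.rfl
  refine ⟨F, ?_, ?_, ?_⟩
  · refine ⟨fun h => ?_⟩
    obtain ⟨q, -, hq⟩ := hF.1 (Filter.empty_mem_iff_bot.2 h)
    obtain ⟨x, hx⟩ := (OrderDual.ofDual q).2.2
    exact hq hx
  · intro s hs
    obtain ⟨q, hq, hqs⟩ := hF.1 hs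
    exact ⟨_, hF.2 ⟨q, hq, Subset.rfl⟩, (OrderDual.ofDual q).2.1, hqs⟩
  · intro C hC hCB hfreq
    obtain ⟨q, hq | hq, hqI⟩ := Order.cofinal_meets_idealOfCofinals p 𝒟 ⟨C, hC⟩
    · obtain ⟨A, hA, hqA⟩ := hq
      exact ⟨A, hA, hF.2 ⟨q, hqI, hqA⟩⟩
    · have hqF : (OrderDual.ofDual q).1 ∈ F := hF.2 ⟨q, hqI, Subset.rfl⟩
      -- If `q` ruled out `D C`, then `q ∩ A`, nonempty because `F` frequently meets `⋃₀ C`, would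
      -- be a forbidden extension.
      obtain ⟨x, ⟨A, hA, hxA⟩, hxq⟩ := (hfreq.and_eventually hqF).exists
      exact (hq (OrderDual.toDual ⟨(OrderDual.ofDual q).1 ∩ A,
        hinter _ (OrderDual.ofDual q).2.1 _ (hCB hA), x, hxq, hxA⟩) inter_subset_left
        ⟨A, hA, inter_subset_right⟩).elim

/-! ### Semantics and syntactic operations -/

namespace Formula

variable {L : FirstOrder.Language.{u, v}}

section Realize

variable {M : Type w} [L.Structure M] {n : ℕ}

@[simp]
theorem realize_equal (s t : L.Term (Fin n)) (a : Fin n → M) :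
    (equal s t).Realize a ↔ s.realize a = t.realize a := by
  rw [Realize]

@[simp]
theorem realize_rel {l : ℕ} (R : L.Relations l) (ts : Fin l → L.Term (Fin n)) (a : Fin n → M) :
    (rel R ts).Realize a ↔
      FirstOrder.Language.Structure.RelMap R (fun i => (ts i).realize a) := by
  rw [Realize]

@[simp]
theorem realize_neg (φ : Formula L n) (a : Fin n → M) : φ.neg.Realize a ↔ ¬ φ.Realize a := by
  rw [Realize]

@[simp]
theorem realize_conj (I : Set ℕ) (φ : I → Formula L n) (a : Fin n → M) :
    (conj I φ).Realize a ↔ ∀ i, (φ i).Realize a := by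
  rw [Realize]

@[simp]
theorem realize_disj (I : Set ℕ) (φ : I → Formula L n) (a : Fin n → M) :
    (disj I φ).Realize a ↔ ∃ i, (φ i).Realize a := by
  rw [Realize]

@[simp]
theorem realize_all (φ : Formula L (n + 1)) (a : Fin n → M) :
    φ.all.Realize a ↔ ∀ b : M, φ.Realize (Fin.snoc (α := fun _ => M) a b) := by
  rw [Realize]

@[simp]
theorem realize_ex (φ : Formula L (n + 1)) (a : Fin n → M) :
    φ.ex.Realize a ↔ ∃ b : M, φ.Realize (Fin.snoc (α := fun _ => M) a b) := by
  rw [Realize]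

@[simp]
theorem realize_and (φ ψ : Formula L n) (a : Fin n → M) :
    (φ.and ψ).Realize a ↔ φ.Realize a ∧ ψ.Realize a := by
  rw [Formula.and, realize_conj]
  refine ⟨fun h => ⟨by simpa using h ⟨0, by simp⟩, by simpa using h ⟨1, by simp⟩⟩, ?_⟩
  rintro ⟨h₁, h₂⟩ ⟨i, rfl | rfl⟩
  · simpa using h₁
  · simpa using h₂

@[simp]
theorem realize_or (φ ψ : Formula L n) (a : Fin n → M) :
    (φ.or ψ).Realize a ↔ φ.Realize a ∨ ψ.Realize a := by
  rw [Formula.or, realize_disj]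
  constructor
  · rintro ⟨⟨i, rfl | rfl⟩, h⟩
    · exact Or.inl (by simpa using h)
    · exact Or.inr (by simpa using h)
  · rintro (h | h)
    · exact ⟨⟨0, by simp⟩, by simpa using h⟩
    · exact ⟨⟨1, by simp⟩, by simpa using h⟩

@[simp]
theorem realize_imp (φ ψ : Formula L n) (a : Fin n → M) :
    (φ.imp ψ).Realize a ↔ (φ.Realize a → ψ.Realize a) := by
  simp [imp, imp_iff_not_or]

theorem realize_alls {n : ℕ} (φ : Formula L n) (e : Fin 0 → M) :
    φ.alls.Realize e ↔ ∀ a : Fin n → M, φ.Realize a := by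
  induction n with
  | zero => exact ⟨fun h a => Subsingleton.elim e a ▸ h, fun h => h e⟩
  | succ n ih =>
    rw [alls, ih]
    simp only [realize_all]
    refine ⟨fun h a => ?_, fun h a b => h _⟩
    simpa using h (Fin.init a) (a (Fin.last n))

end Realize

/-- Renaming of the free variables. -/
def relabel : {n m : ℕ} → Formula L n → (Fin n → Fin m) → Formula L m
  | _, _, equal s t, g => equal (s.relabel g) (t.relabel g)
  | _, _, rel R ts, g => rel R fun i => (ts i).relabel g
  | _, _, neg φ, g => neg (φ.relabel g)
  | _, _, conj I φ, g => conj I fun i => (φ i).relabel g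
  | _, _, disj I φ, g => disj I fun i => (φ i).relabel g
  | _, m, all φ, g =>
    all (φ.relabel (Fin.snoc (α := fun _ => Fin (m + 1)) (Fin.castSucc ∘ g) (Fin.last m)))
  | _, m, ex φ, g =>
    ex (φ.relabel (Fin.snoc (α := fun _ => Fin (m + 1)) (Fin.castSucc ∘ g) (Fin.last m)))

theorem snoc_comp_snoc_castSucc {α : Type*} {n m : ℕ} (a : Fin m → α) (b : α)
    (g : Fin n → Fin m) :
    Fin.snoc (α := fun _ => α) a b ∘
        Fin.snoc (α := fun _ => Fin (m + 1)) (Fin.castSucc ∘ g) (Fin.last m) =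
      Fin.snoc (α := fun _ => α) (a ∘ g) b := by
  rw [Fin.comp_snoc, ← Function.comp_assoc, Fin.snoc_comp_castSucc, Fin.snoc_last]

theorem realize_relabel {M : Type w} [L.Structure M] {n m : ℕ} (φ : Formula L n)
    (g : Fin n → Fin m) (a : Fin m → M) : (φ.relabel g).Realize a ↔ φ.Realize (a ∘ g) := by
  induction φ generalizing m with
  | equal s t => simp [relabel]
  | rel R ts => simp [relabel]
  | neg φ ih => simp [relabel, ih]
  | conj I φ ih => simp [relabel, ih]
  | disj I φ ih => simp [relabel, ih]
  | all φ ih => simp [relabel, ih, snoc_comp_snoc_castSucc]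
  | ex φ ih => simp [relabel, ih, snoc_comp_snoc_castSucc]

theorem IsSigmaOne.relabel {n m : ℕ} {φ : Formula L n} (h : φ.IsSigmaOne) (g : Fin n → Fin m) :
    (φ.relabel g).IsSigmaOne := by
  induction h generalizing m with
  | equal s t => exact .equal _ _
  | rel R ts => exact .rel _ _
  | conj I φ hI _ ih => exact .conj _ _ hI fun i => ih i g
  | disj I φ _ ih => exact .disj _ _ fun i => ih i g
  | ex φ _ ih => exact .ex _ (ih _)

theorem IsSigmaOne.and {n : ℕ} {φ ψ : Formula L n} (hφ : φ.IsSigmaOne) (hψ : ψ.IsSigmaOne) :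
    (φ.and ψ).IsSigmaOne := by
  refine .conj _ _ (by simp) fun i => ?_
  split_ifs
  exacts [hφ, hψ]

/-- Existential quantification over the last `m` variables. -/
def exs {n : ℕ} : {m : ℕ} → Formula L (n + m) → Formula L n
  | 0, φ => φ
  | _ + 1, φ => exs (ex φ)

theorem realize_exs {M : Type w} [L.Structure M] {n m : ℕ} (φ : Formula L (n + m))
    (a : Fin n → M) : φ.exs.Realize a ↔ ∃ b : Fin m → M, φ.Realize (Fin.append a b) := by
  induction m with
  | zero =>
    refine ⟨fun h => ⟨Fin.elim0, by simpa [exs] using h⟩, fun ⟨b, hb⟩ => ?_⟩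
    rw [Subsingleton.elim b Fin.elim0] at hb
    simpa [exs] using hb
  | succ m ih =>
    rw [exs, ih]
    simp only [realize_ex]
    refine ⟨fun ⟨b, c, h⟩ => ⟨Fin.snoc (α := fun _ => M) b c, ?_⟩, fun ⟨b, h⟩ =>
      ⟨Fin.init b, b (Fin.last m), ?_⟩⟩
    · rwa [Fin.append_snoc]
    · rwa [← Fin.append_snoc, Fin.snoc_init_self]

theorem IsSigmaOne.exs {n m : ℕ} {φ : Formula L (n + m)} (h : φ.IsSigmaOne) :
    φ.exs.IsSigmaOne := by
  induction m with
  | zero => exact h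
  | succ m ih => exact ih (.ex _ h)

/-- The conjunction of the equations between the variables `f i` and `g i`. -/
def eqs {n l : ℕ} (f g : Fin l → Fin n) : Formula L n :=
  conj {j | j < l} fun j => equal (.var (f ⟨j, j.2⟩)) (.var (g ⟨j, j.2⟩))

theorem isSigmaOne_eqs {n l : ℕ} (f g : Fin l → Fin n) : (eqs (L := L) f g).IsSigmaOne :=
  .conj _ _ (Set.finite_lt_nat l) fun _ => .equal _ _

theorem realize_eqs {M : Type w} [L.Structure M] {n l : ℕ} (f g : Fin l → Fin n)
    (a : Fin n → M) : (eqs (L := L) f g).Realize a ↔ a ∘ f = a ∘ g := by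
  simp only [eqs, realize_conj, realize_equal, FirstOrder.Language.Term.realize_var, funext_iff,
    Function.comp_apply]
  exact ⟨fun h i => h ⟨i, i.2⟩, fun h i => h ⟨i, i.2⟩⟩

/-- The set of subformulas of a formula. -/
def subformulas : {n : ℕ} → Formula L n → Set (Σ n, Formula L n)
  | _, equal s t => {⟨_, equal s t⟩}
  | _, rel R ts => {⟨_, rel R ts⟩}
  | _, neg φ => insert ⟨_, neg φ⟩ φ.subformulas
  | _, conj I φ => insert ⟨_, conj I φ⟩ (⋃ i, (φ i).subformulas)
  | _, disj I φ => insert ⟨_, disj I φ⟩ (⋃ i, (φ i).subformulas)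
  | _, all φ => insert ⟨_, all φ⟩ φ.subformulas
  | _, ex φ => insert ⟨_, ex φ⟩ φ.subformulas

/-- Keeps the number of genericity requirements countable; it rests on the index sets being subsets
of `ℕ`. -/
theorem countable_subformulas {n : ℕ} (φ : Formula L n) : φ.subformulas.Countable := by
  induction φ with
  | equal s t => exact countable_singleton _
  | rel R ts => exact countable_singleton _
  | neg φ ih => exact ih.insert _
  | conj I φ ih => exact (countable_iUnion ih).insert _
  | disj I φ ih => exact (countable_iUnion ih).insert _
  | all φ ih => exact ih.insert _
  | ex φ ih => exact ih.insert _

theorem mem_subformulas {n : ℕ} (φ : Formula L n) : ⟨n, φ⟩ ∈ φ.subformulas := by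
  cases φ <;> simp [subformulas]

end Formula

/-! ### Points and the `Σ₁` conditions on them -/

open Formula

variable {L : FirstOrder.Language.{u, v}}

/-- A model of `T` together with an assignment of elements to the variables in `V`. -/
structure Point (T : Theory L) (V : Type w) where
  /-- The underlying set. -/
  carrier : Type w
  [str : L.Structure carrier]
  isModel : IsModel carrier T
  /-- The assignment. -/
  val : V → carrier

namespace Point

attribute [instance] Point.str

variable {T : Theory L} {V : Type w}

/-- The set of points satisfying a formula at a tuple of variables. -/
def sat {n : ℕ} (φ : Formula L n) (a : Fin n → V) : Set (Point T V) :=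
  {x | φ.Realize (x.val ∘ a)}

theorem mem_sat {n : ℕ} {φ : Formula L n} {a : Fin n → V} {x : Point T V} :
    x ∈ sat φ a ↔ φ.Realize (x.val ∘ a) := Iff.rfl

theorem mem_sat_snoc {n : ℕ} {φ : Formula L (n + 1)} {a : Fin n → V} {v : V} {x : Point T V} :
    x ∈ sat φ (Fin.snoc (α := fun _ => V) a v) ↔
      φ.Realize (Fin.snoc (α := fun _ => x.carrier) (x.val ∘ a) (x.val v)) := by
  rw [mem_sat, Fin.comp_snoc]

/-- Sets of points definable by a `Σ₁` formula. -/
def basicSets (T : Theory L) (V : Type w) : Set (Set (Point T V)) :=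
  {s | ∃ (n : ℕ) (φ : Formula L n) (a : Fin n → V), φ.IsSigmaOne ∧ s = sat φ a}

theorem sat_mem_basicSets {n : ℕ} {φ : Formula L n} (h : φ.IsSigmaOne) (a : Fin n → V) :
    sat φ a ∈ basicSets T V := ⟨n, φ, a, h, rfl⟩

theorem univ_mem_basicSets : univ ∈ basicSets T V :=
  ⟨0, .conj ∅ fun _ => .conj ∅ fun i => i.2.elim, Fin.elim0,
    .conj _ _ finite_empty fun i => i.2.elim, by ext; simp [mem_sat]⟩

theorem inter_mem_basicSets {s t : Set (Point T V)} (hs : s ∈ basicSets T V)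
    (ht : t ∈ basicSets T V) : s ∩ t ∈ basicSets T V := by
  obtain ⟨n, φ, a, hφ, rfl⟩ := hs
  obtain ⟨m, ψ, b, hψ, rfl⟩ := ht
  refine ⟨n + m, (φ.relabel (Fin.castAdd m)).and (ψ.relabel (Fin.natAdd n)), Fin.append a b,
    (hφ.relabel _).and (hψ.relabel _), ?_⟩
  ext x
  simp only [mem_inter_iff, mem_sat, realize_and, realize_relabel]
  have h1 : (x.val ∘ Fin.append a b) ∘ Fin.castAdd m = x.val ∘ a := by
    ext; simp
  have h2 : (x.val ∘ Fin.append a b) ∘ Fin.natAdd n = x.val ∘ b := by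
    ext; simp
  rw [h1, h2]

/-- A basic set meeting `∃ x, φ` meets `φ(v)` for some variable `v`. -/
theorem exists_inter_sat_snoc_nonempty
    (hV : Infinite V ∨ ∀ (M : Type w) [L.Structure M], IsModel M T → IsEmpty M)
    {n : ℕ} {φ : Formula L (n + 1)} {a : Fin n → V} {s : Set (Point T V)}
    (hs : s ∈ basicSets T V) (h : (s ∩ sat φ.ex a).Nonempty) :
    ∃ v, (s ∩ sat φ (Fin.snoc (α := fun _ => V) a v)).Nonempty := by
  classical
  obtain ⟨m, θ, e, hθ, rfl⟩ := hs
  obtain ⟨x, hxθ, hx⟩ := h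
  obtain ⟨b, hb⟩ := (realize_ex _ _).1 hx
  obtain hV | hV := hV
  -- A fresh variable can be reassigned to the witness `b` without disturbing the condition or the
  -- parameters.
  · obtain ⟨v, hv⟩ := ((finite_range e).union (finite_range a)).exists_notMem
    have hve (i) : e i ≠ v := fun h => hv (Or.inl ⟨i, h⟩)
    have hva (i) : a i ≠ v := fun h => hv (Or.inr ⟨i, h⟩)
    refine ⟨v, ⟨x.carrier, x.isModel, Function.update x.val v b⟩, ?_, ?_⟩
    · have : Function.update x.val v b ∘ e = x.val ∘ e := by
        ext i; simp [hve]
      rw [mem_sat, this]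
      exact hxθ
    · have : Function.update x.val v b ∘ a = x.val ∘ a := by
        ext i; simp [hva]
      rw [mem_sat_snoc, this]
      simpa using hb
  · exact ((hV x.carrier x.isModel).false b).elim

/-- If every `Σ₁` formula satisfiable over `T` is satisfiable together with `φ`, then every nonempty
basic set meets `φ(a)`. -/
theorem inter_sat_nonempty {n : ℕ} {φ : Formula L n}
    (h : ∀ θ : Formula L n, θ.IsSigmaOne → SatisfiableOver.{u, v, w} T θ →
      SatisfiableOver.{u, v, w} T (φ.and θ))
    (a : Fin n → V) {s : Set (Point T V)} (hs : s ∈ basicSets T V) (hne : s.Nonempty) :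
    (s ∩ sat φ a).Nonempty := by
  classical
  obtain ⟨k, θ, e, hθ, rfl⟩ := hs
  obtain ⟨x, hx⟩ := hne
  -- `S` holds all variables mentioned. Making it nonempty whenever `V` is forces the new model to
  -- be nonempty, so that the other variables can be given values.
  obtain ⟨S, hS, hSne⟩ : ∃ S : Finset V, range e ∪ range a ⊆ S ∧ (Nonempty V → S.Nonempty) := by
    by_cases hV : Nonempty V
    · obtain ⟨v⟩ := hV
      refine ⟨insert v (((finite_range e).union (finite_range a)).toFinset), ?_, by simp⟩
      intro y hy
      simp only [Finset.coe_insert, Finite.coe_toFinset]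
      exact Or.inr hy
    · exact ⟨((finite_range e).union (finite_range a)).toFinset, by simp, fun h => (hV h).elim⟩
  let c : Fin S.card → V := fun i => S.equivFin.symm i
  have hc : Function.Injective c := Subtype.val_injective.comp S.equivFin.symm.injective
  let e' : Fin k → Fin S.card := fun i => S.equivFin ⟨e i, hS (Or.inl ⟨i, rfl⟩)⟩
  let a' : Fin n → Fin S.card := fun i => S.equivFin ⟨a i, hS (Or.inr ⟨i, rfl⟩)⟩
  have he : c ∘ e' = e := by ext; simp [c, e']
  have ha : c ∘ a' = a := by ext; simp [c, a']
  -- The condition may involve variables outside `a`, and `a` may repeat variables. So `θ` is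
  -- projected to the tuple `z` at `a`: some values `y` of the variables in `S` satisfy `θ` and
  -- induce `z`.
  let χ : Formula L (n + S.card) := (θ.relabel (Fin.natAdd n ∘ e')).and
    (eqs (Fin.castAdd S.card) (Fin.natAdd n ∘ a'))
  have hχ : χ.exs.IsSigmaOne := ((hθ.relabel _).and (isSigmaOne_eqs _ _)).exs
  have hreal (M : Type w) [L.Structure M] (z : Fin n → M) :
      χ.exs.Realize z ↔ ∃ y : Fin S.card → M, θ.Realize (y ∘ e') ∧ z = y ∘ a' := by
    rw [realize_exs]
    refine exists_congr fun y => ?_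
    have h1 : Fin.append z y ∘ Fin.castAdd S.card = z := by ext; simp
    have h2 : Fin.append z y ∘ Fin.natAdd n = y := by ext; simp
    simp only [χ, realize_and, realize_relabel, realize_eqs, ← Function.comp_assoc, h1, h2]
  obtain ⟨M, _, hM, z, hz⟩ := h χ.exs hχ ⟨x.carrier, x.str, x.isModel, x.val ∘ a,
    (hreal _ _).2 ⟨x.val ∘ c, by rwa [Function.comp_assoc, he],
      by rw [Function.comp_assoc, ha]⟩⟩
  obtain ⟨hφ, hz⟩ := (realize_and _ _ _).1 hz
  obtain ⟨y, hy, rfl⟩ := (hreal _ _).1 hz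
  obtain ⟨d⟩ : Nonempty (V → M) := by
    by_cases hV : Nonempty V
    · obtain ⟨v, hv⟩ := hSne hV
      exact ⟨fun _ => y (S.equivFin ⟨v, hv⟩)⟩
    · exact ⟨fun v => (hV ⟨v⟩).elim⟩
  have hyc : Function.extend c y d ∘ c = y := funext fun i => hc.extend_apply _ _ _
  refine ⟨⟨M, hM, Function.extend c y d⟩, ?_, ?_⟩
  · rw [mem_sat, ← he, ← Function.comp_assoc]
    change θ.Realize ((Function.extend c y d ∘ c) ∘ e')
    rwa [hyc]
  · rw [mem_sat, ← ha, ← Function.comp_assoc]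
    change φ.Realize ((Function.extend c y d ∘ c) ∘ a')
    rwa [hyc]

/-- Families of sets of points whose union is dense in the set of points satisfying a formula. -/
def cover : {n : ℕ} → Formula L n → (Fin n → V) → Set (Set (Point T V))
  | _, disj _ φ, a => range fun i => sat (φ i) a
  | _, ex φ, a => range fun v => sat φ (Fin.snoc (α := fun _ => V) a v)
  | _, φ, a => {sat φ a}

/-- Identification of the variables which have eventually the same value. -/
def eventuallyEq (F : Filter (Point T V)) : Setoid V where
  r v w := ∀ᶠ x in F, x.val v = x.val w
  iseqv := ⟨fun _ => .of_forall fun _ => rfl, fun h => h.mono fun _ => Eq.symm, fun h₁ h₂ => by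
    filter_upwards [h₁, h₂] with x using Eq.trans⟩

end Point

/-! ### The structure of variables -/

open Point FirstOrder.Language

variable {T : Theory L} {V : Type w}

/-- Every function of the language has eventually constant values among the variables. -/
def HasValues (F : Filter (Point T V)) : Prop :=
  ∀ ⦃l : ℕ⦄ (f : L.Functions l) (a : Fin l → V),
    ∃ v, ∀ᶠ x in F, Structure.funMap f (x.val ∘ a) = x.val v

/-- The structure of variables, where what holds eventually along `F` is true. -/
def GenericModel (F : Filter (Point T V)) (_ : HasValues F) : Type w :=
  Quotient (eventuallyEq F)

namespace GenericModel

variable {F : Filter (Point T V)} {hF : HasValues F}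

/-- The element named by a variable. -/
def mk (v : V) : GenericModel F hF := Quotient.mk (eventuallyEq F) v

theorem mk_eq_mk {v w : V} :
    (mk v : GenericModel F hF) = mk w ↔ ∀ᶠ x in F, x.val v = x.val w :=
  Quotient.eq (r := eventuallyEq F)

/-- A variable naming an element. -/
noncomputable def out (c : GenericModel F hF) : V := Quotient.out c

theorem mk_out (c : GenericModel F hF) : mk c.out = c := Quotient.out_eq c

theorem exists_mk_eq (c : GenericModel F hF) : ∃ v, mk v = c := ⟨_, mk_out c⟩

theorem eventually_out_mk {n : ℕ} (a : Fin n → V) :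
    ∀ᶠ x in F, (x.val ∘ fun i => (mk (a i) : GenericModel F hF).out) = x.val ∘ a := by
  have : ∀ᶠ x in F, ∀ i, x.val (mk (a i) : GenericModel F hF).out = x.val (a i) :=
    eventually_all.2 fun i => (mk_eq_mk (hF := hF)).1 (mk_out _)
  exact this.mono fun x hx => funext hx

/-- Defined through chosen representatives; `funMap_mk` and `relMap_mk` show that the choice is
immaterial. -/
noncomputable instance : L.Structure (GenericModel F hF) where
  funMap f c := mk (hF f fun i => (c i).out).choose
  RelMap R c := ∀ᶠ x in F, Structure.RelMap R (x.val ∘ fun i => (c i).out)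

theorem funMap_mk {l : ℕ} (f : L.Functions l) (a : Fin l → V) {v : V}
    (hv : ∀ᶠ x in F, Structure.funMap f (x.val ∘ a) = x.val v) :
    Structure.funMap f (fun i => (mk (a i) : GenericModel F hF)) = mk v := by
  refine mk_eq_mk.2 ?_
  filter_upwards [hv, (hF f fun i => (mk (a i) : GenericModel F hF).out).choose_spec,
    eventually_out_mk (hF := hF) a] with x h1 h2 h3
  rw [← h2, h3, h1]

theorem relMap_mk {l : ℕ} (R : L.Relations l) (a : Fin l → V) :
    Structure.RelMap R (fun i => (mk (a i) : GenericModel F hF)) ↔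
      ∀ᶠ x in F, Structure.RelMap R (x.val ∘ a) :=
  eventually_congr ((eventually_out_mk (hF := hF) a).mono fun x hx => by rw [hx])

theorem exists_realize_term {n : ℕ} (t : L.Term (Fin n)) (a : Fin n → V) :
    ∃ v, t.realize (fun i => (mk (a i) : GenericModel F hF)) = mk v ∧
      ∀ᶠ x in F, t.realize (x.val ∘ a) = x.val v := by
  induction t with
  | var i => exact ⟨a i, rfl, .of_forall fun _ => rfl⟩
  | func f ts ih =>
    choose b hb hbF using ih
    obtain ⟨v, hv⟩ := hF f b
    refine ⟨v, ?_, ?_⟩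
    · simp only [Term.realize_func, hb]
      exact funMap_mk f b hv
    · filter_upwards [hv, eventually_all.2 hbF] with x h1 h2
      simp only [Term.realize_func, h2]
      exact h1

theorem realize_equal_mk {n : ℕ} (s t : L.Term (Fin n)) (a : Fin n → V) :
    (equal s t).Realize (fun i => (mk (a i) : GenericModel F hF)) ↔
      ∀ᶠ x in F, x ∈ sat (equal s t) a := by
  obtain ⟨v, hv, hvF⟩ := exists_realize_term (hF := hF) s a
  obtain ⟨w, hw, hwF⟩ := exists_realize_term (hF := hF) t a
  rw [realize_equal, hv, hw, mk_eq_mk]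
  refine eventually_congr ?_
  filter_upwards [hvF, hwF] with x h1 h2
  rw [mem_sat, realize_equal, h1, h2]

theorem realize_rel_mk {n l : ℕ} (R : L.Relations l) (ts : Fin l → L.Term (Fin n))
    (a : Fin n → V) :
    (rel R ts).Realize (fun i => (mk (a i) : GenericModel F hF)) ↔
      ∀ᶠ x in F, x ∈ sat (rel R ts) a := by
  choose b hb hbF using fun i => exists_realize_term (hF := hF) (ts i) a
  simp only [realize_rel, hb]
  rw [relMap_mk]
  refine eventually_congr ((eventually_all.2 hbF).mono fun x hx => ?_)
  simp only [mem_sat, realize_rel, hx]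
  rfl

theorem mk_snoc {n : ℕ} (a : Fin n → V) (v : V) :
    (fun i => (mk (Fin.snoc (α := fun _ => V) a v i) : GenericModel F hF)) =
      Fin.snoc (α := fun _ => GenericModel F hF) (fun i => mk (a i)) (mk v) :=
  Fin.comp_snoc (mk : V → GenericModel F hF) a v

/-- No genericity is needed here: atomic truth is eventual truth by construction, finite
conjunctions survive since filters are closed under finite intersections, and every element is named
by a variable. -/
theorem _root_.InfinitaryLogic.Formula.IsSigmaOne.eventually_of_realize {n : ℕ} {φ : Formula L n} (h : φ.IsSigmaOne)
    (a : Fin n → V) (hφ : φ.Realize fun i => (mk (a i) : GenericModel F hF)) :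
    ∀ᶠ x in F, x ∈ sat φ a := by
  induction h with
  | equal s t => exact (realize_equal_mk s t a).1 hφ
  | rel R ts => exact (realize_rel_mk R ts a).1 hφ
  | conj I φ hI _ ih =>
    have := hI.to_subtype
    rw [realize_conj] at hφ
    exact (eventually_all.2 fun i => ih i a (hφ i)).mono fun x hx => (realize_conj _ _ _).2 hx
  | disj I φ _ ih =>
    obtain ⟨i, hi⟩ := (realize_disj _ _ _).1 hφ
    exact (ih i a hi).mono fun x hx => (realize_disj _ _ _).2 ⟨i, hx⟩
  | ex φ _ ih =>
    obtain ⟨c, hc⟩ := (realize_ex _ _).1 hφ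
    obtain ⟨v, rfl⟩ := exists_mk_eq c
    rw [← mk_snoc] at hc
    exact (ih _ hc).mono fun x hx => (realize_ex _ _).2 ⟨_, mem_sat_snoc.1 hx⟩

end GenericModel

/-! ### Genericity and the truth lemmas -/

/-- Genericity of a filter on points with respect to a set of formulas. -/
structure IsGeneric (F : Filter (Point T V)) (𝓕 : Set (Σ n, Formula L n)) : Prop where
  neBot : F.NeBot
  exists_basic : ∀ s ∈ F, ∃ t ∈ F, t ∈ basicSets T V ∧ t ⊆ s
  exists_mem_cover : ∀ {n : ℕ} {φ : Formula L n}, ⟨n, φ⟩ ∈ 𝓕 → ∀ a : Fin n → V,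
    cover φ a ⊆ basicSets T V → (∃ᶠ x in F, x ∈ ⋃₀ cover φ a) →
      ∃ A ∈ cover (T := T) φ a, A ∈ F

/-- Formulas have finitely many variables, so countable `V` and `𝓕` yield countably many covers. -/
theorem exists_isGeneric [Countable V] [Nonempty (Point T V)] {𝓕 : Set (Σ n, Formula L n)}
    (h𝓕 : 𝓕.Countable) : ∃ F : Filter (Point T V), IsGeneric F 𝓕 := by
  have := h𝓕.to_subtype
  obtain ⟨F, h1, h2, h3⟩ := exists_generic_filter (basicSets T V) univ_mem_basicSets
    (fun s hs t ht => inter_mem_basicSets hs ht)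
    (range fun p : Σ q : 𝓕, (Fin q.1.1 → V) => cover p.1.1.2 p.2) (countable_range _)
  exact ⟨F, h1, h2, fun {n φ} hφ a => h3 _ ⟨⟨⟨⟨n, φ⟩, hφ⟩, a⟩, rfl⟩⟩

namespace IsGeneric

variable {F : Filter (Point T V)} {𝓕 : Set (Σ n, Formula L n)}

/-- The cover of `∃` need not exhaust its points, since a witness may be unnamed; but every
condition meeting `∃` meets the cover, which is all that genericity requires. -/
theorem exists_eventually_snoc (hG : IsGeneric F 𝓕)
    (hV : Infinite V ∨ ∀ (M : Type w) [L.Structure M], IsModel M T → IsEmpty M)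
    {n : ℕ} {φ : Formula L (n + 1)} (hφ : φ.IsSigmaOne) (hmem : ⟨n, φ.ex⟩ ∈ 𝓕) {a : Fin n → V}
    (h : ∃ᶠ x in F, x ∈ sat φ.ex a) :
    ∃ v, ∀ᶠ x in F, x ∈ sat φ (Fin.snoc (α := fun _ => V) a v) := by
  obtain ⟨_, ⟨v, rfl⟩, hv⟩ := hG.exists_mem_cover hmem a
    (by rintro _ ⟨v, rfl⟩; exact sat_mem_basicSets hφ _) <| by
      refine frequently_iff.2 fun {s} hs => ?_
      obtain ⟨t, htF, ht, hts⟩ := hG.exists_basic s hs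
      obtain ⟨x, hxt, hx⟩ := frequently_iff.1 h htF
      obtain ⟨v, y, hyt, hy⟩ := exists_inter_sat_snoc_nonempty hV ht ⟨x, hxt, hx⟩
      exact ⟨y, hts hyt, _, ⟨v, rfl⟩, hy⟩
  exact ⟨v, hv⟩

theorem exists_eventually_disj (hG : IsGeneric F 𝓕) {n : ℕ} {I : Set ℕ} {φ : I → Formula L n}
    (hφ : ∀ i, (φ i).IsSigmaOne) (hmem : ⟨n, disj I φ⟩ ∈ 𝓕) {a : Fin n → V}
    (h : ∃ᶠ x in F, x ∈ sat (disj I φ) a) : ∃ i, ∀ᶠ x in F, x ∈ sat (φ i) a := by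
  obtain ⟨_, ⟨i, rfl⟩, hi⟩ := hG.exists_mem_cover hmem a
    (by rintro _ ⟨i, rfl⟩; exact sat_mem_basicSets (hφ i) _) (h.mono fun x hx => by
      obtain ⟨i, hi⟩ := (realize_disj _ _ _).1 hx
      exact ⟨_, ⟨i, rfl⟩, hi⟩)
  exact ⟨i, hi⟩

/-- The formula expressing that a function is defined. -/
def functionValue {l : ℕ} (f : L.Functions l) : Formula L (l + 1) :=
  equal (.func f fun i => .var i.castSucc) (.var (Fin.last l))

/-- The formula `∃ y, f(x) = y` holds at every point, so genericity names its witness. -/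
theorem hasValues (hG : IsGeneric F 𝓕)
    (hV : Infinite V ∨ ∀ (M : Type w) [L.Structure M], IsModel M T → IsEmpty M)
    (hfun : ∀ {l : ℕ} (f : L.Functions l), ⟨l, (functionValue f).ex⟩ ∈ 𝓕) : HasValues F := by
  intro l f a
  have := hG.neBot
  obtain ⟨v, hv⟩ := hG.exists_eventually_snoc hV (.equal _ _) (hfun f) (a := a)
    (Eventually.frequently <| .of_forall fun x => by
      simp [mem_sat])
  refine ⟨v, hv.mono fun x hx => ?_⟩
  rw [mem_sat_snoc] at hx
  simpa [functionValue, Function.comp_def] using hx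

open GenericModel

variable {hF : HasValues F}

/-- For an atomic formula the cover is a single set, so genericity upgrades frequent truth to
eventual truth; `⋁` and `∃` first select an instance that is eventually true. -/
theorem realize_of_isSigmaOne (hG : IsGeneric F 𝓕)
    (hV : Infinite V ∨ ∀ (M : Type w) [L.Structure M], IsModel M T → IsEmpty M)
    {n : ℕ} {φ : Formula L n} (h : φ.IsSigmaOne) (hsub : φ.subformulas ⊆ 𝓕) (a : Fin n → V)
    (hφ : ∃ᶠ x in F, x ∈ sat φ a) : φ.Realize fun i => (GenericModel.mk (a i) : GenericModel F hF) := by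
  have := hG.neBot
  induction h with
  | equal s t =>
    obtain ⟨_, rfl, hA⟩ := hG.exists_mem_cover (hsub (mem_subformulas _)) a
      (by rintro _ rfl; exact sat_mem_basicSets (.equal s t) _) (by simpa [cover] using hφ)
    exact (realize_equal_mk s t a).2 hA
  | rel R ts =>
    obtain ⟨_, rfl, hA⟩ := hG.exists_mem_cover (hsub (mem_subformulas _)) a
      (by rintro _ rfl; exact sat_mem_basicSets (.rel R ts) _) (by simpa [cover] using hφ)
    exact (realize_rel_mk R ts a).2 hA
  | conj I φ hI _ ih =>
    rw [subformulas, insert_subset_iff, iUnion_subset_iff] at hsub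
    exact (realize_conj _ _ _).2 fun i => ih i (hsub.2 i) a
      (hφ.mono fun x hx => (realize_conj _ _ _).1 hx i)
  | disj I φ h ih =>
    rw [subformulas, insert_subset_iff, iUnion_subset_iff] at hsub
    obtain ⟨i, hi⟩ := hG.exists_eventually_disj h hsub.1 hφ
    exact (realize_disj _ _ _).2 ⟨i, ih i (hsub.2 i) a hi.frequently⟩
  | ex φ h ih =>
    rw [subformulas, insert_subset_iff] at hsub
    obtain ⟨v, hv⟩ := hG.exists_eventually_snoc hV h hsub.1 hφ
    exact (realize_ex _ _).2 ⟨GenericModel.mk v, mk_snoc (hF := hF) a v ▸ ih hsub.2 _ hv.frequently⟩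

/-- Frequent failure descends to some conjunct, by finiteness, and to every disjunct and every named
instance of `∃`. The base cases are the two directions of the `Σ₁` truth lemma. -/
theorem not_realize_of_isSigmaTwo (hG : IsGeneric F 𝓕)
    (hV : Infinite V ∨ ∀ (M : Type w) [L.Structure M], IsModel M T → IsEmpty M)
    {n : ℕ} {φ : Formula L n} (h : φ.IsSigmaTwo) (hsub : φ.subformulas ⊆ 𝓕) (a : Fin n → V)
    (hφ : ∃ᶠ x in F, x ∉ sat φ a) : ¬ φ.Realize fun i => (GenericModel.mk (a i) : GenericModel F hF) := by
  induction h with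
  | sigmaOne φ h => exact fun h' => hφ ((h.eventually_of_realize a h').mono fun x hx => not_not.2 hx)
  | neg_sigmaOne φ h =>
    rw [subformulas, insert_subset_iff] at hsub
    rw [realize_neg, not_not]
    exact hG.realize_of_isSigmaOne hV h hsub.2 a
      (hφ.mono fun x hx => by rwa [mem_sat, realize_neg, not_not] at hx)
  | conj I φ hI _ ih =>
    rw [subformulas, insert_subset_iff, iUnion_subset_iff] at hsub
    have := hI.to_subtype
    intro h
    refine hφ ?_
    have : ∀ᶠ x in F, ∀ i, x ∈ sat (φ i) a := by
      refine eventually_all.2 fun i => ?_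
      by_contra hi
      exact ih i (hsub.2 i) a (not_eventually.1 hi) ((realize_conj _ _ _).1 h i)
    exact this.mono fun x hx => not_not.2 ((realize_conj _ _ _).2 hx)
  | disj I φ _ ih =>
    rw [subformulas, insert_subset_iff, iUnion_subset_iff] at hsub
    intro h
    obtain ⟨i, hi⟩ := (realize_disj _ _ _).1 h
    exact ih i (hsub.2 i) a (hφ.mono fun x hx h => hx ((realize_disj _ _ _).2 ⟨i, h⟩)) hi
  | ex φ _ ih =>
    rw [subformulas, insert_subset_iff] at hsub
    intro h
    obtain ⟨c, hc⟩ := (realize_ex _ _).1 h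
    obtain ⟨v, rfl⟩ := exists_mk_eq c
    rw [← mk_snoc] at hc
    exact ih hsub.2 _ (hφ.mono fun x hx h => hx ((realize_ex _ _).2 ⟨_, mem_sat_snoc.1 h⟩)) hc

/-- Dually, frequent truth descends to some member of a finite disjunction and to every conjunct and
every instance of `∀`. -/
theorem realize_of_isPiTwo (hG : IsGeneric F 𝓕)
    (hV : Infinite V ∨ ∀ (M : Type w) [L.Structure M], IsModel M T → IsEmpty M)
    {n : ℕ} {φ : Formula L n} (h : φ.IsPiTwo) (hsub : φ.subformulas ⊆ 𝓕) (a : Fin n → V)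
    (hφ : ∃ᶠ x in F, x ∈ sat φ a) : φ.Realize fun i => (GenericModel.mk (a i) : GenericModel F hF) := by
  induction h with
  | sigmaOne φ h => exact hG.realize_of_isSigmaOne hV h hsub a hφ
  | neg_sigmaTwo φ h =>
    rw [subformulas, insert_subset_iff] at hsub
    exact (realize_neg _ _).2 (hG.not_realize_of_isSigmaTwo hV h hsub.2 a
      (hφ.mono fun x hx => (realize_neg _ _).1 hx))
  | disj I φ hI _ ih =>
    rw [subformulas, insert_subset_iff, iUnion_subset_iff] at hsub
    have := hI.to_subtype
    by_contra h
    refine hφ ?_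
    have : ∀ᶠ x in F, ∀ i, x ∉ sat (φ i) a := by
      refine eventually_all.2 fun i => ?_
      by_contra hi
      exact h ((realize_disj _ _ _).2 ⟨i, ih i (hsub.2 i) a hi⟩)
    refine this.mono fun x hx h => ?_
    obtain ⟨i, hi⟩ := (realize_disj _ _ _).1 h
    exact hx i hi
  | conj I φ _ ih =>
    rw [subformulas, insert_subset_iff, iUnion_subset_iff] at hsub
    exact (realize_conj _ _ _).2 fun i => ih i (hsub.2 i) a
      (hφ.mono fun x hx => (realize_conj _ _ _).1 hx i)
  | all φ _ ih =>
    rw [subformulas, insert_subset_iff] at hsub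
    refine (realize_all _ _).2 fun c => ?_
    obtain ⟨v, rfl⟩ := exists_mk_eq c
    rw [← mk_snoc]
    exact ih hsub.2 _ (hφ.mono fun x hx => mem_sat_snoc.2 ((realize_all _ _).1 hx _))

end IsGeneric

/-! ### Assembling the model -/

/-- Countably many `Π₂` formulas, each satisfied in every nonempty basic set of points at every
tuple of variables, hold everywhere in some structure. -/
theorem exists_forall_realize [Countable (Σ l, L.Functions l)] [Countable V] [Nonempty (Point T V)]
    (hV : Infinite V ∨ ∀ (M : Type w) [L.Structure M], IsModel M T → IsEmpty M)
    {𝓠 : Set (Σ n, Formula L n)} (h𝓠 : 𝓠.Countable) (hpi : ∀ p ∈ 𝓠, p.2.IsPiTwo)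
    (hdense : ∀ p ∈ 𝓠, ∀ (a : Fin p.1 → V), ∀ s ∈ basicSets T V, s.Nonempty →
      (s ∩ sat p.2 a).Nonempty) :
    ∃ (M : Type w) (_ : L.Structure M), ∀ p ∈ 𝓠, ∀ a : Fin p.1 → M, p.2.Realize a := by
  let 𝓕 : Set (Σ n, Formula L n) := (⋃ p ∈ 𝓠, p.2.subformulas) ∪
    range fun f : Σ l, L.Functions l => ⟨f.1, (IsGeneric.functionValue f.2).ex⟩
  have h𝓕 : 𝓕.Countable :=
    (h𝓠.biUnion fun p _ => countable_subformulas p.2).union (countable_range _)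
  obtain ⟨F, hG⟩ := exists_isGeneric (T := T) (V := V) h𝓕
  have hF := hG.hasValues hV fun {l} f => Or.inr ⟨⟨l, f⟩, rfl⟩
  refine ⟨GenericModel F hF, inferInstance, fun p hp a => ?_⟩
  choose b hb using fun i => (a i).exists_mk_eq
  obtain rfl : (fun i => GenericModel.mk (b i)) = a := funext hb
  refine hG.realize_of_isPiTwo hV (hpi p hp)
    ((subset_biUnion_of_mem (u := fun p => p.2.subformulas) hp).trans subset_union_left) b ?_
  -- Every set in `F` contains a nonempty condition, which by density meets the formula.
  refine frequently_iff.2 fun {s} hs => ?_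
  obtain ⟨t, htF, ht, hts⟩ := hG.exists_basic s hs
  have := hG.neBot
  obtain ⟨x, hxt, hx⟩ := hdense p hp b t ht (nonempty_of_mem htF)
  exact ⟨x, hts hxt, hx⟩

/-- Infinitely many variables can only be assigned in a nonempty model. If `T` has only empty
models, no variables are used and the structure built is empty. -/
theorem exists_variables (hT : Satisfiable.{u, v, w} T) :
    ∃ V : Type w, Countable V ∧ Nonempty (Point T V) ∧
      (Infinite V ∨ ∀ (M : Type w) [L.Structure M], IsModel M T → IsEmpty M) := by
  by_cases h : ∀ (M : Type w) [L.Structure M], IsModel M T → IsEmpty M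
  · obtain ⟨M, _, hM⟩ := hT
    exact ⟨PEmpty, inferInstance, ⟨⟨M, hM, PEmpty.elim⟩⟩, Or.inr h⟩
  · push Not at h
    obtain ⟨M, _, hM, ⟨b⟩⟩ := h
    exact ⟨ULift ℕ, inferInstance, ⟨⟨M, hM, fun _ => b⟩⟩, Or.inl inferInstance⟩

/-- Omitting types, for `Π₂` formulas. -/
theorem satisfiable_union_alls [Countable (Σ l, L.Functions l)] (hT : T.Countable)
    (hTpi : ∀ σ ∈ T, σ.IsPiTwo) (hTsat : Satisfiable.{u, v, w} T) {ι : Type x} [Countable ι]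
    {n : ι → ℕ} {φ : ∀ i, Formula L (n i)} (hφ : ∀ i, (φ i).IsPiTwo)
    (h : ∀ i, ∀ θ : Formula L (n i), θ.IsSigmaOne → SatisfiableOver.{u, v, w} T θ →
      SatisfiableOver.{u, v, w} T ((φ i).and θ)) :
    Satisfiable.{u, v, w} (T ∪ Set.range fun i => (φ i).alls) := by
  obtain ⟨V, _, _, hV⟩ := exists_variables hTsat
  let 𝓠 : Set (Σ n, Formula L n) := (fun σ => ⟨0, σ⟩) '' T ∪ range fun i => ⟨n i, φ i⟩
  obtain ⟨M, _, hM⟩ := exists_forall_realize hV (𝓠 := 𝓠)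
    ((hT.image _).union (countable_range _))
    (by
      rintro _ (⟨σ, hσ, rfl⟩ | ⟨i, rfl⟩)
      exacts [hTpi σ hσ, hφ i])
    (by
      rintro _ (⟨σ, hσ, rfl⟩ | ⟨i, rfl⟩) a s hs hne
      · obtain ⟨x, hx⟩ := hne
        exact ⟨x, hx, mem_sat.2 (Subsingleton.elim Fin.elim0 (x.val ∘ a) ▸ x.isModel σ hσ)⟩
      · exact inter_sat_nonempty (h i) a hs hne)
  refine ⟨M, inferInstance, ?_⟩
  rintro _ (hσ | ⟨i, rfl⟩)
  · exact hM _ (Or.inl ⟨_, hσ, rfl⟩) _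
  · exact (realize_alls _ _).2 (hM _ (Or.inr ⟨i, rfl⟩))

end InfinitaryLogic

theorem mainTheorem10 (L : FirstOrder.Language.{u, v}) [Countable L.Symbols]
    (T : InfinitaryLogic.Theory L) (hT : T.Countable)
    (hTpi : ∀ σ ∈ T, σ.IsPiTwo) (hTsat : InfinitaryLogic.Satisfiable.{u, v, w} T) :
    (∀ (ι : Type x) [Countable ι] (n : ι → ℕ)
        (φ : ∀ i, InfinitaryLogic.Formula L (n i)),
      (∀ i, (φ i).IsPiTwo) →
      (∀ i, ∀ θ : InfinitaryLogic.Formula L (n i), θ.IsSigmaOne →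
        InfinitaryLogic.SatisfiableOver.{u, v, w} T θ →
        InfinitaryLogic.SatisfiableOver.{u, v, w} T ((φ i).and θ)) →
      InfinitaryLogic.Satisfiable.{u, v, w} (T ∪ Set.range fun i => (φ i).alls)) ∧
    (∀ (ι : Type x) [Countable ι] (n : ι → ℕ)
        (ψ : ∀ i, InfinitaryLogic.Formula L (n i)),
      (∀ i, (ψ i).IsSigmaTwo) →
      (∀ i, ∀ θ : InfinitaryLogic.Formula L (n i), θ.IsSigmaOne →
        InfinitaryLogic.Entails.{u, v, w} T (θ.imp (ψ i)).alls →
        InfinitaryLogic.Entails.{u, v, w} T θ.neg.alls) →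
      InfinitaryLogic.Satisfiable.{u, v, w} (T ∪ Set.range fun i => (ψ i).neg.alls)) := by

  have : Countable (Σ l, L.Functions l) :=
    (Sum.inl_injective : Function.Injective (Sum.inl : _ → L.Symbols)).countable
  refine ⟨fun ι _ n φ hφ h => InfinitaryLogic.satisfiable_union_alls hT hTpi hTsat hφ h,
    fun ι _ n ψ hψ h => InfinitaryLogic.satisfiable_union_alls hT hTpi hTsat
      (fun i => .neg_sigmaTwo _ (hψ i)) fun i θ hθ hsat => ?_⟩
  -- If `¬ψ i ∧ θ` had no model over `T`, then `T` would entail `θ → ψ i`, hence `¬θ`, contradicting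
  -- the satisfiability of `θ`.
  by_contra hns
  obtain ⟨M, _, hM, a, ha⟩ := hsat
  refine (InfinitaryLogic.Formula.realize_neg _ _).1
    ((InfinitaryLogic.Formula.realize_alls _ _).1 (h i θ hθ (fun N _ hN => ?_) M hM) a) ha
  refine (InfinitaryLogic.Formula.realize_alls _ _).2 fun b =>
    (InfinitaryLogic.Formula.realize_imp _ _ _).2 fun hb => ?_
  by_contra hψb
  exact hns ⟨N, inferInstance, hN, b, (InfinitaryLogic.Formula.realize_and _ _ _).2
    ⟨(InfinitaryLogic.Formula.realize_neg _ _).2 hψb, hb⟩⟩
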